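/- Let $\Omega$ be a Boolean algebra, let $\mathbb K\in\{\mathbb R,\mathbb C\}$ and let $B$ be a Banach space over $\mathbb K$. A \emph{precosheaf} $\theta$ on $\Omega$ is a functor from the poset $\Omega$ to Banach spaces and linear contractions, with maps $\theta_{F,E}\colon\theta(F)\to\theta(E)$ for $F\subseteq E$; it is a \emph{cosheaf} (for the finite topology) if for every finite partition $\mathcal E$ of every $E\in\Omega$ the canonical map $\sum_{F\in\mathcal E}\theta(F)\to\theta(E)$ from the $\ell_1$-direct sum is an isometric isomorphism (the empty family is a partition of $0$, so $\theta(0)=0$). A map of precosheaves is a uniformly bounded natural transformation of bounded linear maps. For a cosheaf $\theta$ and $F\subseteq E$, let $p_{E,F}\colon\theta(E)\to\theta(F)$ be the unique bounded linear map with $p_{E,F}\theta_{F,E}=\mathrm{id}$ and $p_{E,F}\theta_{E\setminus F,E}=0$; the spectral measure of $\theta$ on $\theta(E)$ is $F\mapsto P_F=\theta_{F,E}\,p_{E,F}$ $(F\subseteq E)$. Let $\mathrm{bva}(E,B)$ be the space of finitely additive maps $\nu$ of bounded variation from the Boolean algebra $\{G\in\Omega: G\subseteq E\}$ to $B$, with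 the total variation norm $|\nu|(E)=\sup\{\sum_{G\in\mathcal E}\|\nu(G)\| : \mathcal E\text{ a finite partition of }E\}$. For $F\subseteq E$ let $\mathrm{bva}(F,B)\to\mathrm{bva}(E,B)$ send $\nu$ to $G\mapsto\nu(G\cap F)$. \textbf{Theorem.} The precosheaf $E\mapsto\mathrm{bva}(E,B)$ is a cosheaf, the evaluations $\mathrm{ev}_E\colon\nu\mapsto\nu(E)$ form a map of precosheaves, contractive at every $E$, from it to the constant precosheaf $E\mapsto B$, and this map is universal among maps from cosheaves: for every cosheaf $\theta$ and every map of precosheaves $\tau$ from $\theta$ to the constant precosheaf $E\mapsto B$ there is a unique map of precosheaves $T\colon\theta\to\mathrm{bva}(-,B)$ with $\mathrm{ev}_E\circ T_E=\tau_E$ for all $E\in\Omega$. Moreover $\|T_E\|=\|\tau_E\|$ for every $E$ (so $T$ is contractive if $\tau$ is), and $T$ is given by the spectral measure of $\theta$: for $x\in\theta(E)$ and $F\subseteq E$, $$T_E(x)(F)=\tau_F(p_{E,F}x)=\tau_E(P_F x).$$ Thus $E\mapsto\mathrm{bva}(E,B)$ is the cosheafification of the constant precosheaf on $B$, that is, the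 constant cosheaf on $B$. -/

import Mathlib

open scoped ENNReal Topology

universe u v w w' w''

noncomputable section

/-! ### Principal ideals of a Boolean algebra -/

/-- The principal ideal `{G | G ≤ E}` of a Boolean algebra is a Boolean algebra with unit `E`. -/
instance Set.Iic.instBooleanAlgebraOfBooleanAlgebra {Ω : Type*} [BooleanAlgebra Ω] (E : Ω) :
    BooleanAlgebra (Set.Iic E) where
  __ := (inferInstance : Lattice (Set.Iic E))
  __ := (inferInstance : BoundedOrder (Set.Iic E))
  le_sup_inf := fun x y z => Subtype.coe_le_coe.1 (le_sup_inf (x := (x : Ω)) (y := y) (z := z))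
  compl := fun x => ⟨E \ x, sdiff_le⟩
  inf_compl_le_bot := fun x => Subtype.coe_le_coe.1 (by
    change (x : Ω) ⊓ E \ x ≤ ⊥
    simp)
  top_le_sup_compl := fun x => Subtype.coe_le_coe.1 (by
    change E ≤ (x : Ω) ⊔ E \ x
    simp)

/-! ### Finitely additive maps of bounded variation -/

section BoundedVariation

variable {A : Type*} [BooleanAlgebra A] {B : Type*} [NormedAddCommGroup B]

/-- Finite additivity of a map on a Boolean algebra. -/
def IsFinAdditive (ν : A → B) : Prop :=
  ∀ E F : A, Disjoint E F → ν (E ⊔ F) = ν E + ν F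

/-- The variation `|ν|(E) = sup {∑_{F ∈ 𝓔} ‖ν(F)‖}` over the finite partitions `𝓔` of `E`. -/
def variation (ν : A → B) (E : A) : ℝ≥0∞ :=
  ⨆ P : Finpartition E, ∑ F ∈ P.parts, ‖ν F‖ₑ

theorem IsFinAdditive.map_bot {ν : A → B} (h : IsFinAdditive ν) : ν ⊥ = 0 := by
  have := h ⊥ ⊥ disjoint_bot_left
  simpa using this

theorem sum_enorm_le_variation {ν : A → B} (h0 : ν ⊥ = 0) {ι : Type*} (s : Finset ι) (f : ι → A)
    (hd : (s : Set ι).PairwiseDisjoint f) (E : A) (hE : ∀ i ∈ s, f i ≤ E) :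
    ∑ i ∈ s, ‖ν (f i)‖ₑ ≤ variation ν E := by
  classical
  have hd' : ((s.image f : Finset A) : Set A).PairwiseDisjoint id := by
    intro a ha b hb hab
    simp only [Finset.coe_image, Set.mem_image, Finset.mem_coe] at ha hb
    obtain ⟨i, hi, rfl⟩ := ha
    obtain ⟨j, hj, rfl⟩ := hb
    exact hd hi hj (fun hij => hab (by rw [hij]))
  have hsup : (s.image f).sup id ≤ E := by
    refine Finset.sup_le fun a ha => ?_
    obtain ⟨i, hi, rfl⟩ := Finset.mem_image.1 ha
    exact hE i hi
  let P : Finpartition ((s.image f).sup id) :=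
    Finpartition.ofErase (s.image f) (Finset.supIndep_iff_pairwiseDisjoint.2 hd') rfl
  let Q := P.extendOfLE hsup
  calc ∑ i ∈ s, ‖ν (f i)‖ₑ = ∑ i ∈ s with f i ≠ ⊥, ‖ν (f i)‖ₑ := by
        symm
        refine Finset.sum_filter_of_ne fun i _ hne hbot => hne ?_
        rw [hbot, h0, enorm_zero]
    _ = ∑ F ∈ ({i ∈ s | f i ≠ ⊥} : Finset ι).image f, ‖ν F‖ₑ := by
        rw [Finset.sum_image]
        intro i hi j hj hij
        simp only [Finset.coe_filter, Set.mem_ofPred_eq] at hi hj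
        by_contra hne
        have := hd hi.1 hj.1 hne
        rw [Function.onFun, hij] at this
        exact hj.2 (disjoint_self.1 this)
    _ ≤ ∑ F ∈ Q.parts, ‖ν F‖ₑ := by
        refine Finset.sum_le_sum_of_subset ?_
        refine Finset.Subset.trans ?_ (P.parts_subset_extendOfLE hsup)
        intro F hF
        obtain ⟨i, hi, rfl⟩ := Finset.mem_image.1 hF
        rw [Finset.mem_filter] at hi
        exact Finset.mem_erase.2 ⟨hi.2, Finset.mem_image_of_mem f hi.1⟩
    _ ≤ variation ν E := le_iSup (fun P : Finpartition E => ∑ F ∈ P.parts, ‖ν F‖ₑ) Q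

theorem Finpartition.pairwiseDisjoint_parts {E : A} (P : Finpartition E) :
    (P.parts : Set A).PairwiseDisjoint id :=
  Finset.supIndep_iff_pairwiseDisjoint.1 P.supIndep

theorem variation_mono {ν : A → B} (h0 : ν ⊥ = 0) {E F : A} (h : E ≤ F) :
    variation ν E ≤ variation ν F :=
  iSup_le fun P => sum_enorm_le_variation h0 P.parts id P.pairwiseDisjoint_parts F
    fun _ hi => (P.le hi).trans h

theorem enorm_le_variation {ν : A → B} (h0 : ν ⊥ = 0) (E : A) : ‖ν E‖ₑ ≤ variation ν E := by
  simpa using sum_enorm_le_variation h0 {()} (fun _ => E) (by simp) E (by simp)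

theorem variation_add_le (ν ρ : A → B) (E : A) :
    variation (ν + ρ) E ≤ variation ν E + variation ρ E := by
  refine iSup_le fun P => ?_
  calc ∑ F ∈ P.parts, ‖(ν + ρ) F‖ₑ ≤ ∑ F ∈ P.parts, (‖ν F‖ₑ + ‖ρ F‖ₑ) :=
        Finset.sum_le_sum fun F _ => enorm_add_le _ _
    _ = ∑ F ∈ P.parts, ‖ν F‖ₑ + ∑ F ∈ P.parts, ‖ρ F‖ₑ := Finset.sum_add_distrib
    _ ≤ _ := add_le_add (le_iSup (fun P : Finpartition E => ∑ F ∈ P.parts, ‖ν F‖ₑ) P)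
        (le_iSup (fun P : Finpartition E => ∑ F ∈ P.parts, ‖ρ F‖ₑ) P)

theorem variation_smul {𝕜 : Type*} [RCLike 𝕜] [NormedSpace 𝕜 B] (c : 𝕜) (ν : A → B) (E : A) :
    variation (c • ν) E = ‖c‖ₑ * variation ν E := by
  simp only [variation, Pi.smul_apply, enorm_smul, ← Finset.mul_sum, ENNReal.mul_iSup]

theorem variation_zero (E : A) : variation (0 : A → B) E = 0 := by
  simp [variation]

variable (𝕜 : Type*) [RCLike 𝕜] (A B) [NormedSpace 𝕜 B]

/-- The finitely additive maps of bounded variation, as a linear subspace of all maps. -/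
def bvSubmodule : Submodule 𝕜 (A → B) where
  carrier := {ν | IsFinAdditive ν ∧ ∀ E, variation ν E < ∞}
  zero_mem' := ⟨fun _ _ _ => by simp, fun E => by simp [variation_zero]⟩
  add_mem' := fun {ν ρ} hν hρ => ⟨fun E F h => by
      simp only [Pi.add_apply, hν.1 E F h, hρ.1 E F h]; abel,
    fun E => (variation_add_le ν ρ E).trans_lt (ENNReal.add_lt_top.2 ⟨hν.2 E, hρ.2 E⟩)⟩
  smul_mem' := fun c ν hν => ⟨fun E F h => by
      simp only [Pi.smul_apply, hν.1 E F h, smul_add],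
    fun E => by
      rw [variation_smul]
      exact ENNReal.mul_lt_top enorm_lt_top (hν.2 E)⟩

/-- The space of finitely additive maps `A → B` of bounded variation. -/
def BVAdditive : Type _ := bvSubmodule A B 𝕜

namespace BVAdditive

instance : AddCommGroup (BVAdditive A B 𝕜) := inferInstanceAs (AddCommGroup (bvSubmodule A B 𝕜))

instance : Module 𝕜 (BVAdditive A B 𝕜) := inferInstanceAs (Module 𝕜 (bvSubmodule A B 𝕜))

/-- An additive map of bounded variation, as an element of the space of all of them. -/
def mk {A : Type*} [BooleanAlgebra A] {B : Type*} [NormedAddCommGroup B] {𝕜 : Type*} [RCLike 𝕜]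
    [NormedSpace 𝕜 B] (ν : A → B) (h : IsFinAdditive ν) (h' : ∀ E, variation ν E < ∞) :
    BVAdditive A B 𝕜 :=
  ⟨ν, h, h'⟩

instance : FunLike (BVAdditive A B 𝕜) A B where
  coe ν := ν.1
  coe_injective := Subtype.val_injective

variable {A B 𝕜}

@[ext]
theorem ext {ν ρ : BVAdditive A B 𝕜} (h : ∀ E, ν E = ρ E) : ν = ρ := DFunLike.ext _ _ h

theorem isFinAdditive (ν : BVAdditive A B 𝕜) : IsFinAdditive ν := ν.2.1

theorem variation_lt_top (ν : BVAdditive A B 𝕜) (E : A) : variation ν E < ∞ := ν.2.2 E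

@[simp] theorem add_apply (ν ρ : BVAdditive A B 𝕜) (E : A) : (ν + ρ) E = ν E + ρ E := rfl

@[simp] theorem sub_apply (ν ρ : BVAdditive A B 𝕜) (E : A) : (ν - ρ) E = ν E - ρ E := rfl

@[simp] theorem smul_apply (c : 𝕜) (ν : BVAdditive A B 𝕜) (E : A) : (c • ν) E = c • ν E := rfl

@[simp] theorem zero_apply (E : A) : (0 : BVAdditive A B 𝕜) E = 0 := rfl

/-- The total variation norm `|ν|(⊤)`. -/
instance : Norm (BVAdditive A B 𝕜) := ⟨fun ν => (variation ν ⊤).toReal⟩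

theorem norm_def (ν : BVAdditive A B 𝕜) : ‖ν‖ = (variation ν ⊤).toReal := rfl

theorem ofReal_norm (ν : BVAdditive A B 𝕜) : ENNReal.ofReal ‖ν‖ = variation ν ⊤ :=
  ENNReal.ofReal_toReal (ν.variation_lt_top ⊤).ne

theorem norm_apply_le (ν : BVAdditive A B 𝕜) (E : A) : ‖ν E‖ ≤ ‖ν‖ := by
  rw [norm_def, ← toReal_enorm]
  exact ENNReal.toReal_mono (ν.variation_lt_top ⊤).ne
    ((enorm_le_variation ν.isFinAdditive.map_bot E).trans
      (variation_mono ν.isFinAdditive.map_bot le_top))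

theorem normCore : NormedSpace.Core 𝕜 (BVAdditive A B 𝕜) where
  norm_nonneg _ := ENNReal.toReal_nonneg
  norm_smul c ν := by
    have : variation (c • ν : BVAdditive A B 𝕜) ⊤ = ‖c‖ₑ * variation ν ⊤ := variation_smul c ν ⊤
    rw [norm_def, this, ENNReal.toReal_mul, toReal_enorm, norm_def]
  norm_triangle ν ρ := by
    rw [norm_def, norm_def, norm_def,
      ← ENNReal.toReal_add (ν.variation_lt_top ⊤).ne (ρ.variation_lt_top ⊤).ne]
    exact ENNReal.toReal_mono
      (ENNReal.add_lt_top.2 ⟨ν.variation_lt_top ⊤, ρ.variation_lt_top ⊤⟩).ne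
      (variation_add_le ν ρ ⊤)
  norm_eq_zero_iff ν := by
    refine ⟨fun h => ext fun E => ?_, ?_⟩
    · have := norm_apply_le ν E
      rw [h] at this
      simpa using norm_le_zero_iff.1 this
    · rintro rfl
      have : variation (0 : BVAdditive A B 𝕜) ⊤ = 0 := variation_zero (B := B) (⊤ : A)
      rw [norm_def, this, ENNReal.toReal_zero]

instance : NormedAddCommGroup (BVAdditive A B 𝕜) := NormedAddCommGroup.ofCore normCore

instance : NormedSpace 𝕜 (BVAdditive A B 𝕜) := NormedSpace.ofCore normCore

instance [CompleteSpace B] : CompleteSpace (BVAdditive A B 𝕜) := by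
  refine Metric.complete_of_cauchySeq_tendsto fun u hu => ?_
  have hpt : ∀ E : A, ∃ b, Filter.Tendsto (fun n => u n E) Filter.atTop (𝓝 b) := fun E => by
    refine cauchySeq_tendsto_of_complete (Metric.cauchySeq_iff.2 fun ε hε => ?_)
    obtain ⟨N, hN⟩ := Metric.cauchySeq_iff.1 hu ε hε
    refine ⟨N, fun m hm n hn => lt_of_le_of_lt ?_ (hN m hm n hn)⟩
    rw [dist_eq_norm, dist_eq_norm, ← sub_apply]
    exact norm_apply_le _ E
  choose ν hν using hpt
  have hadd : IsFinAdditive ν := fun E F h => by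
    refine tendsto_nhds_unique (hν (E ⊔ F)) ?_
    refine ((hν E).add (hν F)).congr fun n => ?_
    exact ((u n).isFinAdditive E F h).symm
  have key : ∀ ε > 0, ∃ N, ∀ n ≥ N, ∀ E, variation ((u n : A → B) - ν) E ≤ ENNReal.ofReal ε := by
    intro ε hε
    obtain ⟨N, hN⟩ := Metric.cauchySeq_iff.1 hu ε hε
    refine ⟨N, fun n hn E => iSup_le fun P => ?_⟩
    have hlim : Filter.Tendsto (fun m => ∑ F ∈ P.parts, ‖u n F - u m F‖ₑ) Filter.atTop
        (𝓝 (∑ F ∈ P.parts, ‖u n F - ν F‖ₑ)) :=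
      tendsto_finsetSum _ fun F _ => (tendsto_const_nhds.sub (hν F)).enorm
    refine le_of_tendsto hlim (Filter.eventually_atTop.2 ⟨N, fun m hm => ?_⟩)
    have h0 := (u n - u m).isFinAdditive.map_bot
    calc ∑ F ∈ P.parts, ‖u n F - u m F‖ₑ ≤ variation (u n - u m : BVAdditive A B 𝕜) ⊤ :=
          sum_enorm_le_variation h0 P.parts id P.pairwiseDisjoint_parts ⊤ fun _ _ => le_top
      _ = ENNReal.ofReal ‖u n - u m‖ := (ofReal_norm _).symm
      _ ≤ ENNReal.ofReal ε := ENNReal.ofReal_le_ofReal (by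
          rw [← dist_eq_norm]; exact (hN n hn m hm).le)
  have hmem : ν ∈ bvSubmodule A B 𝕜 := by
    obtain ⟨N, hN⟩ := key 1 one_pos
    have h1 : ((u N : A → B) - ν) ∈ bvSubmodule A B 𝕜 :=
      ⟨fun E F h => by
        simp only [Pi.sub_apply, hadd E F h, (u N).isFinAdditive E F h]; abel,
       fun E => (hN N le_rfl E).trans_lt ENNReal.ofReal_lt_top⟩
    have h2 := (bvSubmodule A B 𝕜).sub_mem (u N).2 h1
    have h3 : (u N).1 - ((u N : A → B) - ν) = ν := sub_sub_cancel _ _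
    rwa [h3] at h2
  refine ⟨BVAdditive.mk ν hmem.1 hmem.2, Metric.tendsto_atTop.2 fun ε hε => ?_⟩
  obtain ⟨N, hN⟩ := key (ε / 2) (half_pos hε)
  refine ⟨N, fun n hn => ?_⟩
  rw [dist_eq_norm, norm_def]
  change (variation ((u n : A → B) - ν) ⊤).toReal < ε
  refine lt_of_le_of_lt (ENNReal.toReal_mono ENNReal.ofReal_ne_top (hN n hn ⊤)) ?_
  rw [ENNReal.toReal_ofReal (half_pos hε).le]
  exact half_lt_self hε

variable (A B 𝕜) in
/-- Evaluation at the unit, a linear contraction. -/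
def evalTop : BVAdditive A B 𝕜 →L[𝕜] B :=
  LinearMap.mkContinuous
    { toFun := fun ν => ν ⊤
      map_add' := fun _ _ => rfl
      map_smul' := fun _ _ => rfl } 1 fun ν => by
    rw [one_mul]
    exact norm_apply_le ν ⊤

end BVAdditive

end BoundedVariation

/-! ### Precosheaves and cosheaves of Banach spaces -/

/-- A precosheaf of Banach spaces on a Boolean algebra `Ω`: a functor from the poset `Ω` to Banach
spaces and linear contractions. -/
structure Precosheaf (𝕜 : Type u) [RCLike 𝕜] (Ω : Type v) [BooleanAlgebra Ω] where
  obj : Ω → Type w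
  [normedAddCommGroup : ∀ E, NormedAddCommGroup (obj E)]
  [normedSpace : ∀ E, NormedSpace 𝕜 (obj E)]
  [completeSpace : ∀ E, CompleteSpace (obj E)]
  map : ∀ {F E : Ω}, F ≤ E → obj F →L[𝕜] obj E
  map_id : ∀ E, map (le_refl E) = ContinuousLinearMap.id 𝕜 (obj E)
  map_comp : ∀ {G F E : Ω} (h : G ≤ F) (h' : F ≤ E), map h' ∘L map h = map (h.trans h')
  norm_map_le : ∀ {F E : Ω} (h : F ≤ E), ‖map h‖ ≤ 1

namespace Precosheaf

attribute [instance] normedAddCommGroup normedSpace completeSpace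

variable {𝕜 : Type u} [RCLike 𝕜] {Ω : Type v} [BooleanAlgebra Ω]

/-- A map of precosheaves: a uniformly bounded natural transformation. -/
@[ext]
structure Hom (θ : Precosheaf.{u, v, w} 𝕜 Ω) (η : Precosheaf.{u, v, w'} 𝕜 Ω) where
  app : ∀ E, θ.obj E →L[𝕜] η.obj E
  naturality : ∀ {F E : Ω} (h : F ≤ E), app E ∘L θ.map h = η.map h ∘L app F
  bounded : ∃ C : ℝ, ∀ E, ‖app E‖ ≤ C

/-- The composite `σ ∘ τ` of maps of precosheaves. -/
def Hom.comp {θ : Precosheaf.{u, v, w} 𝕜 Ω} {η : Precosheaf.{u, v, w'} 𝕜 Ω}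
    {κ : Precosheaf.{u, v, w''} 𝕜 Ω} (σ : η.Hom κ) (τ : θ.Hom η) : θ.Hom κ where
  app E := σ.app E ∘L τ.app E
  naturality h := by
    rw [ContinuousLinearMap.comp_assoc, τ.naturality, ← ContinuousLinearMap.comp_assoc,
      σ.naturality, ContinuousLinearMap.comp_assoc]
  bounded := by
    obtain ⟨C, hC⟩ := σ.bounded
    obtain ⟨D, hD⟩ := τ.bounded
    exact ⟨C * D, fun E => (ContinuousLinearMap.opNorm_comp_le _ _).trans
      (mul_le_mul (hC E) (hD E) (norm_nonneg _) ((norm_nonneg _).trans (hC E)))⟩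

/-- The canonical map `∑_{F ∈ 𝓔} θ(F) → θ(E)` out of the `ℓ¹`-direct sum over a finite partition
`𝓔` of `E`. -/
def coprodMap (θ : Precosheaf.{u, v, w} 𝕜 Ω) {E : Ω} (P : Finpartition E) :
    PiLp 1 (fun F : P.parts => θ.obj F) →L[𝕜] θ.obj E :=
  ∑ F : P.parts, θ.map (P.le F.2) ∘L PiLp.proj 1 (fun F : P.parts => θ.obj F) F

/-- A precosheaf is a cosheaf (for the finite topology) if for every finite partition `𝓔` of an
element `E` the canonical map `∑_{F ∈ 𝓔} θ(F) → θ(E)` is an isometric isomorphism. -/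
def IsCosheaf (θ : Precosheaf.{u, v, w} 𝕜 Ω) : Prop :=
  ∀ (E : Ω) (P : Finpartition E),
    Isometry (θ.coprodMap P) ∧ Function.Surjective (θ.coprodMap P)

theorem map_map (θ : Precosheaf.{u, v, w} 𝕜 Ω) {G F E : Ω} (h : G ≤ F) (h' : F ≤ E)
    (x : θ.obj G) : θ.map h' (θ.map h x) = θ.map (h.trans h') x :=
  DFunLike.congr_fun (θ.map_comp h h') x

theorem map_id_apply (θ : Precosheaf.{u, v, w} 𝕜 Ω) {E : Ω} (h : E ≤ E) (x : θ.obj E) :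
    θ.map h x = x :=
  DFunLike.congr_fun (θ.map_id E) x

theorem coprodMap_apply (θ : Precosheaf.{u, v, w} 𝕜 Ω) {E : Ω} (P : Finpartition E)
    (v : PiLp 1 (fun F : P.parts => θ.obj F)) :
    θ.coprodMap P v = ∑ F : P.parts, θ.map (P.le F.2) (v F) := by
  simp [coprodMap]

theorem IsCosheaf.eq_zero_of_bot {θ : Precosheaf.{u, v, w} 𝕜 Ω} (hθ : θ.IsCosheaf)
    (x : θ.obj ⊥) : x = 0 := by
  obtain ⟨v, rfl⟩ := (hθ ⊥ (Finpartition.empty Ω)).2 x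
  rw [coprodMap_apply]
  exact Finset.sum_eq_zero fun F _ => absurd F.2 (by simp [Finpartition.empty])

/-- The binary case of the cosheaf condition: `θ(E)` is the `ℓ¹`-sum of `θ(F)` and `θ(E \ F)`. -/
theorem IsCosheaf.binary {θ : Precosheaf.{u, v, w} 𝕜 Ω} (hθ : θ.IsCosheaf) {F G E : Ω}
    (hF : F ≤ E) (hG : G ≤ E) (hd : Disjoint F G) (hs : F ⊔ G = E) :
    (∀ x, ∃ y z, θ.map hF y + θ.map hG z = x) ∧
      ∀ y z, ‖θ.map hF y + θ.map hG z‖ = ‖y‖ + ‖z‖ := by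
  classical
  by_cases hF0 : F = ⊥
  · subst hF0
    obtain rfl : G = E := by simpa using hs
    refine ⟨fun x => ⟨0, x, by simp [map_id_apply]⟩, fun y z => ?_⟩
    rw [hθ.eq_zero_of_bot y]
    simp [map_id_apply]
  by_cases hG0 : G = ⊥
  · subst hG0
    obtain rfl : F = E := by simpa using hs
    refine ⟨fun x => ⟨x, 0, by simp [map_id_apply]⟩, fun y z => ?_⟩
    rw [hθ.eq_zero_of_bot z]
    simp [map_id_apply]
  have hne : F ≠ G := fun h => hF0 (by rw [← h] at hd; exact disjoint_self.1 hd)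
  let P : Finpartition E :=
    { parts := {F, G}
      supIndep := by
        rw [Finset.supIndep_pair hne]
        exact hd
      sup_parts := by simpa using hs
      bot_notMem := by simp [Ne.symm hF0, Ne.symm hG0] }
  have hFP : F ∈ P.parts := by simp [P]
  have hGP : G ∈ P.parts := by simp [P]
  have huniv : (Finset.univ : Finset P.parts) = {⟨F, hFP⟩, ⟨G, hGP⟩} := by
    ext ⟨a, ha⟩
    have : a = F ∨ a = G := by simpa [P] using ha
    simpa using this
  have hne' : (⟨F, hFP⟩ : P.parts) ≠ ⟨G, hGP⟩ := fun h => hne (congrArg Subtype.val h)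
  refine ⟨fun x => ?_, fun y z => ?_⟩
  · obtain ⟨v, rfl⟩ := (hθ E P).2 x
    refine ⟨v ⟨F, hFP⟩, v ⟨G, hGP⟩, ?_⟩
    rw [coprodMap_apply, huniv, Finset.sum_pair hne']
  · let f : ∀ H : P.parts, θ.obj H :=
      Function.update (Function.update 0 ⟨F, hFP⟩ y) ⟨G, hGP⟩ z
    have hfF : f ⟨F, hFP⟩ = y := by simp [f, Function.update_of_ne hne']
    have hfG : f ⟨G, hGP⟩ = z := by simp [f]
    have h1 := (AddMonoidHomClass.isometry_iff_norm _).1 (hθ E P).1 (WithLp.toLp 1 f)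
    rw [coprodMap_apply, PiLp.norm_eq_of_L1, huniv, Finset.sum_pair hne',
      Finset.sum_pair hne'] at h1
    simpa only [hfF, hfG] using h1

/-- Existence and uniqueness of the cosheaf projections. -/
theorem IsCosheaf.existsUnique_proj {θ : Precosheaf.{u, v, w} 𝕜 Ω} (hθ : θ.IsCosheaf) {F E : Ω}
    (h : F ≤ E) :
    ∃! p : θ.obj E →L[𝕜] θ.obj F,
      p ∘L θ.map h = ContinuousLinearMap.id 𝕜 (θ.obj F) ∧
        p ∘L θ.map (sdiff_le : E \ F ≤ E) = 0 := by
  obtain ⟨hs, hn⟩ := hθ.binary h (sdiff_le : E \ F ≤ E) disjoint_sdiff_self_right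
    (sup_sdiff_cancel_right h)
  have hinj : ∀ y y' z z', θ.map h y + θ.map (sdiff_le : E \ F ≤ E) z =
      θ.map h y' + θ.map (sdiff_le : E \ F ≤ E) z' → y = y' := by
    intro y y' z z' heq
    have h0 : θ.map h (y - y') + θ.map (sdiff_le : E \ F ≤ E) (z - z') = 0 := by
      rw [map_sub, map_sub, sub_add_sub_comm, heq, sub_self]
    have h1 := hn (y - y') (z - z')
    rw [h0, norm_zero] at h1
    have h2 : ‖y - y'‖ = 0 :=
      le_antisymm (by linarith [norm_nonneg (z - z')]) (norm_nonneg _)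
    exact sub_eq_zero.1 (norm_eq_zero.1 h2)
  choose a b hab using hs
  let p : θ.obj E →L[𝕜] θ.obj F := LinearMap.mkContinuous
    { toFun := a
      map_add' := fun x x' => by
        refine hinj _ _ (b (x + x')) (b x + b x') ?_
        rw [hab, map_add, map_add, add_add_add_comm, hab, hab]
      map_smul' := fun c x => by
        refine hinj _ _ (b (c • x)) (c • b x) ?_
        rw [hab, RingHom.id_apply, map_smul, map_smul, ← smul_add, hab] } 1 fun x => by
    have h1 := hn (a x) (b x)
    rw [hab] at h1
    change ‖a x‖ ≤ 1 * ‖x‖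
    rw [h1, one_mul]
    exact le_add_of_nonneg_right (norm_nonneg _)
  refine ⟨p, ⟨ContinuousLinearMap.ext fun y => ?_, ContinuousLinearMap.ext fun z => ?_⟩, ?_⟩
  · change a _ = y
    refine hinj _ _ (b (θ.map h y)) 0 ?_
    rw [map_zero, add_zero]
    exact hab _
  · change a _ = 0
    refine hinj _ _ (b (θ.map sdiff_le z)) z ?_
    rw [map_zero, zero_add]
    exact hab _
  · rintro q ⟨hq1, hq2⟩
    refine ContinuousLinearMap.ext fun x => ?_
    change q x = a x
    have e1 : q (θ.map h (a x)) = a x := DFunLike.congr_fun hq1 (a x)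
    have e2 : q (θ.map sdiff_le (b x)) = 0 := DFunLike.congr_fun hq2 (b x)
    conv_lhs => rw [← hab x, map_add, e1, e2, add_zero]

/-- The cosheaf projection `p_{E,F} : θ(E) → θ(F)`: the unique bounded linear map which is the
identity on `θ(F)` and zero on `θ(E \ F)`. -/
def IsCosheaf.proj {θ : Precosheaf.{u, v, w} 𝕜 Ω} (hθ : θ.IsCosheaf) {F E : Ω} (h : F ≤ E) :
    θ.obj E →L[𝕜] θ.obj F :=
  (hθ.existsUnique_proj h).choose

/-- The spectral measure `F ↦ P_F = θ_{F,E} ∘ p_{E,F}` of a cosheaf on the Banach space `θ(E)`,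
defined on the Boolean algebra of the `F ≤ E`. -/
def IsCosheaf.spectralMeasure {θ : Precosheaf.{u, v, w} 𝕜 Ω} (hθ : θ.IsCosheaf) (E : Ω)
    (F : Set.Iic E) : θ.obj E →L[𝕜] θ.obj E :=
  θ.map F.2 ∘L hθ.proj F.2

theorem variation_pullback_le {B : Type w} [NormedAddCommGroup B]
    [NormedSpace 𝕜 B] {F E : Ω} (ν : BVAdditive (Set.Iic F) B 𝕜)
    (H : Set.Iic E) :
    variation (fun G : Set.Iic E => ν ⟨(G : Ω) ⊓ F, inf_le_right⟩) H ≤ variation ν ⊤ := by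
  refine iSup_le fun P => ?_
  refine sum_enorm_le_variation ν.isFinAdditive.map_bot P.parts
    (fun G : Set.Iic E => (⟨(G : Ω) ⊓ F, inf_le_right⟩ : Set.Iic F)) ?_ ⊤ fun _ _ => le_top
  intro G hG G' hG' hne
  have h1 : Disjoint G G' := P.pairwiseDisjoint_parts hG hG' hne
  rw [disjoint_iff, Subtype.ext_iff] at h1
  have h2 : (G : Ω) ⊓ G' = ⊥ := h1
  refine disjoint_iff.2 (Subtype.ext ?_)
  change ((G : Ω) ⊓ F) ⊓ ((G' : Ω) ⊓ F) = ⊥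
  rw [inf_inf_inf_comm, h2, bot_inf_eq]

variable (𝕜 Ω) (B : Type w) [NormedAddCommGroup B] [NormedSpace 𝕜 B] [CompleteSpace B]

/-- The constant precosheaf `E ↦ B`. -/
def const : Precosheaf.{u, v, w} 𝕜 Ω where
  obj _ := B
  map _ := ContinuousLinearMap.id 𝕜 B
  map_id _ := rfl
  map_comp _ _ := rfl
  norm_map_le _ := ContinuousLinearMap.norm_id_le

variable {Ω} in
/-- For `F ≤ E`, the extension map `ν ↦ (G ↦ ν (G ⊓ F))` from additive maps on the ideal of `F` to
additive maps on the ideal of `E`. -/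
def bvMap {F E : Ω} (h : F ≤ E) :
    BVAdditive (Set.Iic F) B 𝕜 →L[𝕜] BVAdditive (Set.Iic E) B 𝕜 :=
  LinearMap.mkContinuous
    { toFun := fun ν => BVAdditive.mk (fun G => ν ⟨(G : Ω) ⊓ F, inf_le_right⟩) (fun G G' hd => by
          rw [disjoint_iff, Subtype.ext_iff] at hd
          have h2 : (G : Ω) ⊓ G' = ⊥ := hd
          rw [← ν.isFinAdditive]
          · exact congrArg ν (Subtype.ext (inf_sup_right (G : Ω) G' F))
          · refine disjoint_iff.2 (Subtype.ext ?_)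
            change ((G : Ω) ⊓ F) ⊓ ((G' : Ω) ⊓ F) = ⊥
            rw [inf_inf_inf_comm, h2, bot_inf_eq])
        (fun H => (variation_pullback_le ν H).trans_lt (ν.variation_lt_top ⊤))
      map_add' := fun _ _ => rfl
      map_smul' := fun _ _ => rfl } 1 fun ν => by
    rw [one_mul]
    exact ENNReal.toReal_mono (ν.variation_lt_top ⊤).ne (variation_pullback_le ν ⊤)

variable {𝕜 Ω B} in
@[simp]
theorem bvMap_apply {F E : Ω} (h : F ≤ E) (ν : BVAdditive (Set.Iic F) B 𝕜) (G : Set.Iic E) :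
    bvMap 𝕜 B h ν G = ν ⟨(G : Ω) ⊓ F, inf_le_right⟩ := rfl

/-- The precosheaf that sends `E` to the space of finitely additive maps of bounded variation on
the ideal of `E` with values in `B`. -/
def bvAdditive : Precosheaf.{u, v, max v w} 𝕜 Ω where
  obj E := BVAdditive (Set.Iic E) B 𝕜
  map h := bvMap 𝕜 B h
  map_id E := by
    ext ν G
    rw [bvMap_apply]
    congr 1
    exact Subtype.ext (inf_eq_left.2 G.2)
  map_comp {G F E} h h' := by
    ext ν H
    rw [ContinuousLinearMap.comp_apply, bvMap_apply, bvMap_apply, bvMap_apply]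
    congr 1
    refine Subtype.ext ?_
    change ((H : Ω) ⊓ F) ⊓ G = (H : Ω) ⊓ G
    rw [inf_assoc, inf_eq_right.2 h]
  norm_map_le h := LinearMap.mkContinuous_norm_le _ zero_le_one _

variable {𝕜 Ω B} in
/-- The value `ν(F)` of an element `ν` of the precosheaf at `E`, for `F ≤ E`. -/
def bvApply {E : Ω} (ν : (bvAdditive 𝕜 Ω B).obj E) (F : Set.Iic E) : B :=
  (show BVAdditive (Set.Iic E) B 𝕜 from ν) F

/-- Evaluation `ν ↦ ν(E)`, as a map from the precosheaf of additive maps of bounded variation to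
the constant precosheaf. -/
def bvEval : (bvAdditive 𝕜 Ω B).Hom (const 𝕜 Ω B) where
  app E := BVAdditive.evalTop (Set.Iic E) B 𝕜
  naturality {F E} h := by
    refine ContinuousLinearMap.ext fun (ν : BVAdditive (Set.Iic F) B 𝕜) => ?_
    change ν ⟨E ⊓ F, inf_le_right⟩ = ν ⊤
    congr 1
    exact Subtype.ext (inf_eq_right.2 h)
  bounded := ⟨1, fun E => LinearMap.mkContinuous_norm_le _ zero_le_one _⟩

end Precosheaf

end

noncomputable section

/-! ### Superadditivity of the variation -/

section BoundedVariation

variable {A : Type*} [BooleanAlgebra A] {B : Type*} [NormedAddCommGroup B]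

/-! For a partition of `E`, restricting a measure to the parts and extending by zero from the parts
are mutually inverse. Extension is contractive, and the variation is superadditive on disjoint
elements, so the norms of the restrictions add up to at most the total variation
(`sum_norm_restrict_le`). Together these make the canonical map an isometric bijection.

For the universal property, the binary cosheaf condition says that `x` in `θ(E)` splits as an
`ℓ¹`-sum over any `F ≤ E` and its complement. Hence the projections compose (`proj_proj`), and both
`F ↦ p_{E,F} x`, once pushed into `B` by `τ`, and `F ↦ ‖p_{E,F} x‖` are finitely additive. The
second is a positive measure of total mass `‖x‖`; multiplied by `‖τ_E‖` it dominates the first, so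
`F ↦ τ_F (p_{E,F} x)` has variation at most `‖τ_E‖ ‖x‖`. This is the lift. Its naturality is the
base change formula `proj_map`.

Uniqueness holds because naturality determines any lift on the two summands of `x`: at `F`, the
summand over `F` contributes its evaluation, prescribed by `τ`, and the other contributes zero. -/

theorem IsFinAdditive.map_finset_sup {ν : A → B} (h : IsFinAdditive ν) {ι : Type*} (s : Finset ι)
    (f : ι → A) (hd : (s : Set ι).PairwiseDisjoint f) : ν (s.sup f) = ∑ i ∈ s, ν (f i) := by
  classical
  induction s using Finset.induction_on with
  | empty => simpa using h.map_bot
  | insert a s ha ih =>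
    rw [Finset.coe_insert, Set.pairwiseDisjoint_insert_of_notMem (by simpa using ha)] at hd
    rw [Finset.sup_insert, Finset.sum_insert ha, h, ih hd.1]
    exact Finset.disjoint_sup_right.2 fun i hi => hd.2 i hi

theorem IsFinAdditive.sum_parts {ν : A → B} (h : IsFinAdditive ν) {E : A} (P : Finpartition E) :
    ∑ F ∈ P.parts, ν F = ν E := by
  have := h.map_finset_sup P.parts id P.pairwiseDisjoint_parts
  rw [P.sup_parts] at this
  exact this.symm

theorem variation_add_variation_le {ν : A → B} (h0 : ν ⊥ = 0) {E F : A} (h : Disjoint E F) :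
    variation ν E + variation ν F ≤ variation ν (E ⊔ F) := by
  refine ENNReal.iSup_add_iSup_le fun P Q => ?_
  have hPQ : ∀ a ∈ P.parts, ∀ b ∈ Q.parts, Disjoint a b := fun a ha b hb =>
    h.mono (P.le ha) (Q.le hb)
  -- Indexing by the disjoint sum makes the total split into the sums over `P` and `Q` without
  -- comparing the two sets of parts.
  have := sum_enorm_le_variation h0 (P.parts.disjSum Q.parts) (Sum.elim id id) ?_ (E ⊔ F) ?_
  · simpa [Finset.sum_disjSum] using this
  · rintro (a | a) ha (b | b) hb hab
    · exact P.pairwiseDisjoint_parts (by simpa using ha) (by simpa using hb) (by simpa using hab)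
    · exact hPQ a (by simpa using ha) b (by simpa using hb)
    · exact (hPQ b (by simpa using hb) a (by simpa using ha)).symm
    · exact Q.pairwiseDisjoint_parts (by simpa using ha) (by simpa using hb) (by simpa using hab)
  · rintro (a | a) ha
    · exact (P.le (by simpa using ha)).trans le_sup_left
    · exact (Q.le (by simpa using ha)).trans le_sup_right

theorem sum_variation_le {ν : A → B} (h0 : ν ⊥ = 0) {ι : Type*} (s : Finset ι)
    (f : ι → A) (hd : (s : Set ι).PairwiseDisjoint f) :
    ∑ i ∈ s, variation ν (f i) ≤ variation ν (s.sup f) := by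
  classical
  induction s using Finset.induction_on with
  | empty => simp
  | insert a s ha ih =>
    rw [Finset.coe_insert, Set.pairwiseDisjoint_insert_of_notMem (by simpa using ha)] at hd
    rw [Finset.sup_insert, Finset.sum_insert ha]
    exact (add_le_add_right (ih hd.1) _).trans (variation_add_variation_le h0
      (Finset.disjoint_sup_right.2 fun i hi => hd.2 i hi))

/-- The image of a partition under `f` is a disjoint family below `H`. It need not cover `H`, and
some members may be `⊥`; neither matters, since `ν ⊥ = 0`. -/
theorem variation_comp_le {A' : Type*} [BooleanAlgebra A'] {ν : A → B} (h0 : ν ⊥ = 0)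
    (f : A' → A) (hf : ∀ x y, Disjoint x y → Disjoint (f x) (f y)) {E : A'} {H : A}
    (hE : ∀ x ≤ E, f x ≤ H) : variation (fun x => ν (f x)) E ≤ variation ν H :=
  iSup_le fun P => sum_enorm_le_variation h0 P.parts f
    (fun _ hx _ hy hxy => hf _ _ (P.pairwiseDisjoint_parts hx hy hxy)) H fun _ hx => hE _ (P.le hx)

end BoundedVariation

/-! ### Restriction of measures to smaller ideals -/

theorem Set.Iic.disjoint_coe_iff {Ω : Type*} [BooleanAlgebra Ω] {E : Ω} {F G : Set.Iic E} :
    Disjoint (F : Ω) G ↔ Disjoint F G := by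
  rw [disjoint_iff, disjoint_iff, Subtype.ext_iff]
  rfl

namespace BVAdditive

variable {𝕜 : Type*} [RCLike 𝕜] {Ω : Type*} [BooleanAlgebra Ω] {B : Type*}
  [NormedAddCommGroup B] [NormedSpace 𝕜 B]

/-- The inclusion of the ideal of `F` into the ideal of `E`, for `F ≤ E`. -/
def inclIic {F E : Ω} (h : F ≤ E) (G : Set.Iic F) : Set.Iic E := ⟨G, le_trans G.2 h⟩

theorem disjoint_inclIic {F E : Ω} (h : F ≤ E) (G H : Set.Iic F) (hd : Disjoint G H) :
    Disjoint (inclIic h G) (inclIic h H) :=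
  Set.Iic.disjoint_coe_iff.1 (Set.Iic.disjoint_coe_iff.2 hd :)

theorem variation_restrict_le {F E : Ω} (h : F ≤ E) (ν : BVAdditive (Set.Iic E) B 𝕜)
    (H : Set.Iic F) :
    variation (fun G => ν (inclIic h G)) H ≤ variation ν (inclIic h H) :=
  variation_comp_le ν.isFinAdditive.map_bot _ (disjoint_inclIic h) fun _ hx => hx

/-- The restriction of an additive map of bounded variation to a smaller ideal. -/
def restrict {F E : Ω} (h : F ≤ E) (ν : BVAdditive (Set.Iic E) B 𝕜) :
    BVAdditive (Set.Iic F) B 𝕜 :=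
  mk (fun G => ν (inclIic h G))
    (fun _ _ hd => ν.isFinAdditive _ _ (disjoint_inclIic h _ _ hd))
    fun H => (variation_restrict_le h ν H).trans_lt (ν.variation_lt_top _)

@[simp]
theorem restrict_apply {F E : Ω} (h : F ≤ E) (ν : BVAdditive (Set.Iic E) B 𝕜) (G : Set.Iic F) :
    restrict h ν G = ν (inclIic h G) := rfl

theorem sum_apply {A : Type*} [BooleanAlgebra A] {ι : Type*} (s : Finset ι)
    (ν : ι → BVAdditive A B 𝕜) (G : A) : (∑ i ∈ s, ν i) G = ∑ i ∈ s, ν i G := by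
  classical
  induction s using Finset.induction_on with
  | empty => simp
  | insert a s ha ih => rw [Finset.sum_insert ha, Finset.sum_insert ha, add_apply, ih]

/-- The norm of each restriction is at most the variation of `ν` on that part, and superadditivity
sums these. This is the nontrivial half of the isometry. -/
theorem sum_norm_restrict_le {E : Ω} (ν : BVAdditive (Set.Iic E) B 𝕜) (P : Finpartition E) :
    ∑ F : P.parts, ‖restrict (P.le F.2) ν‖ ≤ ‖ν‖ := by
  rw [← ENNReal.ofReal_le_ofReal_iff (norm_nonneg _),
    ENNReal.ofReal_sum_of_nonneg fun _ _ => norm_nonneg _, ofReal_norm]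
  simp_rw [ofReal_norm]
  have hd : ((Finset.univ : Finset P.parts) : Set P.parts).PairwiseDisjoint
      (fun F => (⟨F, P.le F.2⟩ : Set.Iic E)) := fun F _ G _ hFG =>
    Set.Iic.disjoint_coe_iff.1
      (P.pairwiseDisjoint_parts F.2 G.2 fun h => hFG (Subtype.ext h))
  calc ∑ F : P.parts, variation (restrict (P.le F.2) ν) ⊤
      ≤ ∑ F : P.parts, variation ν (⟨F, P.le F.2⟩ : Set.Iic E) :=
        Finset.sum_le_sum fun F _ => variation_restrict_le (P.le F.2) ν ⊤
    _ ≤ variation ν (Finset.univ.sup fun F : P.parts => (⟨F, P.le F.2⟩ : Set.Iic E)) :=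
        sum_variation_le ν.isFinAdditive.map_bot _ _ hd
    _ ≤ variation ν ⊤ := variation_mono ν.isFinAdditive.map_bot le_top

end BVAdditive

namespace Precosheaf

open BVAdditive

/-! ### Measures of bounded variation form a cosheaf -/

section BV

variable {𝕜 : Type u} [RCLike 𝕜] {Ω : Type v} [BooleanAlgebra Ω]
  {B : Type w} [NormedAddCommGroup B] [NormedSpace 𝕜 B] [CompleteSpace B]

theorem restrict_bvMap_self {F E : Ω} (h : F ≤ E) (ν : BVAdditive (Set.Iic F) B 𝕜) :
    restrict h (bvMap 𝕜 B h ν) = ν := by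
  ext G
  rw [restrict_apply, bvMap_apply]
  exact congrArg ν (Subtype.ext (inf_eq_left.2 G.2))

theorem restrict_bvMap_of_disjoint {F G E : Ω} (hF : F ≤ E) (hG : G ≤ E) (hd : Disjoint F G)
    (ν : BVAdditive (Set.Iic G) B 𝕜) : restrict hF (bvMap 𝕜 B hG ν) = 0 := by
  ext H
  rw [restrict_apply, bvMap_apply, BVAdditive.zero_apply, ← ν.isFinAdditive.map_bot]
  exact congrArg ν (Subtype.ext (disjoint_iff.1 (hd.mono_left H.2)))

theorem restrict_sum_bvMap {E : Ω} (P : Finpartition E)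
    (ν : ∀ F : P.parts, BVAdditive (Set.Iic (F : Ω)) B 𝕜) (F : P.parts) :
    restrict (P.le F.2) (∑ G : P.parts, bvMap 𝕜 B (P.le G.2) (ν G)) = ν F := by
  have h1 : restrict (P.le F.2) (∑ G : P.parts, bvMap 𝕜 B (P.le G.2) (ν G)) =
      ∑ G : P.parts, restrict (P.le F.2) (bvMap 𝕜 B (P.le G.2) (ν G)) := by
    ext H
    rw [restrict_apply, BVAdditive.sum_apply, BVAdditive.sum_apply]
    rfl
  rw [h1, Finset.sum_eq_single F, restrict_bvMap_self]
  · intro G _ hG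
    exact restrict_bvMap_of_disjoint _ _
      (P.pairwiseDisjoint_parts F.2 G.2 fun h => hG (Subtype.ext h.symm)) _
  · simp

theorem sum_bvMap_restrict {E : Ω} (P : Finpartition E) (ν : BVAdditive (Set.Iic E) B 𝕜) :
    ∑ F : P.parts, bvMap 𝕜 B (P.le F.2) (restrict (P.le F.2) ν) = ν := by
  ext G
  rw [BVAdditive.sum_apply]
  -- With `G` fixed, `F ↦ ν (G ⊓ F)` makes sense on all of `Ω`, so its additivity applies directly
  -- to the partition `P` of `E` in `Ω`.
  have hadd : IsFinAdditive fun F : Ω => ν ⟨(G : Ω) ⊓ F, inf_le_left.trans G.2⟩ := by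
    intro F F' hd
    rw [← ν.isFinAdditive]
    · exact congrArg ν (Subtype.ext (inf_sup_left (G : Ω) F F'))
    · exact Set.Iic.disjoint_coe_iff.1 (hd.mono inf_le_right inf_le_right)
  have h := hadd.sum_parts P
  rw [← Finset.sum_coe_sort] at h
  refine h.trans (congrArg ν (Subtype.ext (inf_eq_left.2 G.2)))

/-- The upper bound holds because the extensions are contractions. For the lower bound, restricting
the sum to a part recovers the component there. Restrictions also provide the preimage for
surjectivity. -/
theorem isCosheaf_bvAdditive : (bvAdditive 𝕜 Ω B).IsCosheaf := by
  refine fun E P => ⟨(AddMonoidHomClass.isometry_iff_norm _).2 fun ν => ?_, fun ν => ?_⟩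
  · rw [coprodMap_apply, PiLp.norm_eq_of_L1]
    refine le_antisymm ((norm_sum_le _ _).trans (Finset.sum_le_sum fun F _ => ?_)) ?_
    · exact ((bvAdditive 𝕜 Ω B).map _).le_of_opNorm_le_of_le
        ((bvAdditive 𝕜 Ω B).norm_map_le _) le_rfl |>.trans_eq (one_mul _)
    · have h := sum_norm_restrict_le
        (∑ G : P.parts, bvMap 𝕜 B (P.le G.2) (show BVAdditive (Set.Iic (G : Ω)) B 𝕜 from ν G)) P
      exact (Finset.sum_congr rfl fun F _ =>
        (congrArg norm (restrict_sum_bvMap P ν F)).symm).trans_le h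
  · refine ⟨WithLp.toLp 1 fun F : P.parts => restrict (P.le F.2) ν, ?_⟩
    rw [coprodMap_apply]
    exact sum_bvMap_restrict P ν

end BV

/-! ### Calculus of the cosheaf projections -/

namespace IsCosheaf

variable {𝕜 : Type u} [RCLike 𝕜] {Ω : Type v} [BooleanAlgebra Ω]
  {θ : Precosheaf.{u, v, w'} 𝕜 Ω} (hθ : θ.IsCosheaf)

theorem proj_map_self {F E : Ω} (h : F ≤ E) (x : θ.obj F) : hθ.proj h (θ.map h x) = x :=
  DFunLike.congr_fun (hθ.existsUnique_proj h).choose_spec.1.1 x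

theorem proj_map_of_disjoint {F G E : Ω} (h : F ≤ E) (hG : G ≤ E) (hd : Disjoint F G)
    (x : θ.obj G) : hθ.proj h (θ.map hG x) = 0 := by
  -- Since `G ≤ E \ F`, the map from `θ(G)` factors through `θ(E \ F)`, which the projection kills.
  rw [← θ.map_map (le_sdiff.2 ⟨hG, hd.symm⟩ : G ≤ E \ F) sdiff_le]
  exact DFunLike.congr_fun (hθ.existsUnique_proj h).choose_spec.1.2 _

theorem proj_self {E : Ω} (h : E ≤ E) (x : θ.obj E) : hθ.proj h x = x := by
  conv_lhs => rw [← θ.map_id_apply h x]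
  exact hθ.proj_map_self h x

theorem exists_eq_map_add_map (hθ : θ.IsCosheaf) {F E : Ω} (h : F ≤ E) (x : θ.obj E) :
    ∃ (a : θ.obj F) (b : θ.obj (E \ F)), x = θ.map h a + θ.map sdiff_le b := by
  obtain ⟨a, b, hab⟩ := (hθ.binary h (sdiff_le : E \ F ≤ E) disjoint_sdiff_self_right
    (sup_sdiff_cancel_right h)).1 x
  exact ⟨a, b, hab.symm⟩

theorem proj_proj {G F E : Ω} (hG : G ≤ F) (hF : F ≤ E) (x : θ.obj E) :
    hθ.proj hG (hθ.proj hF x) = hθ.proj (hG.trans hF) x := by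
  -- Splitting twice writes `x` as a sum of pieces over `G`, `F \ G` and `E \ F`; both sides return
  -- the piece over `G`.
  obtain ⟨u, c, rfl⟩ := hθ.exists_eq_map_add_map hF x
  obtain ⟨a, b, rfl⟩ := hθ.exists_eq_map_add_map hG u
  rw [map_add, hθ.proj_map_self, hθ.proj_map_of_disjoint hF _ disjoint_sdiff_self_right, add_zero,
    map_add, map_add, map_add, map_add, θ.map_map, θ.map_map, hθ.proj_map_self, hθ.proj_map_self,
    hθ.proj_map_of_disjoint _ _ disjoint_sdiff_self_right,
    hθ.proj_map_of_disjoint _ _ disjoint_sdiff_self_right,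
    hθ.proj_map_of_disjoint _ _ (disjoint_sdiff_self_right.mono_left hG), add_zero, add_zero]

theorem map_proj_add_map_proj {F G E : Ω} (hF : F ≤ E) (hG : G ≤ E) (hd : Disjoint F G)
    (hs : F ⊔ G = E) (x : θ.obj E) :
    θ.map hF (hθ.proj hF x) + θ.map hG (hθ.proj hG x) = x := by
  obtain ⟨a, b, rfl⟩ := (hθ.binary hF hG hd hs).1 x
  rw [map_add, map_add (hθ.proj hG), hθ.proj_map_self, hθ.proj_map_self,
    hθ.proj_map_of_disjoint _ _ hd, hθ.proj_map_of_disjoint _ _ hd.symm, add_zero, zero_add]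

theorem norm_proj_add_norm_proj {F G E : Ω} (hF : F ≤ E) (hG : G ≤ E) (hd : Disjoint F G)
    (hs : F ⊔ G = E) (x : θ.obj E) : ‖hθ.proj hF x‖ + ‖hθ.proj hG x‖ = ‖x‖ := by
  rw [← (hθ.binary hF hG hd hs).2, hθ.map_proj_add_map_proj hF hG hd hs]

/-- The binary `ℓ¹` identity, applied to the projection of `x` to `F ⊔ G`. The resulting scalar
measure controls the variation of the lift. -/
theorem isFinAdditive_norm_proj {E : Ω} (x : θ.obj E) :
    IsFinAdditive fun F : Set.Iic E => ‖hθ.proj F.2 x‖ := by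
  intro F G hd
  have h := hθ.norm_proj_add_norm_proj (le_sup_left : (F : Ω) ≤ F ⊔ G) le_sup_right
    (Set.Iic.disjoint_coe_iff.2 hd) rfl (hθ.proj (sup_le F.2 G.2) x)
  rw [hθ.proj_proj, hθ.proj_proj] at h
  exact h.symm

/-- Base change: of the pieces of `x` over `G ⊓ F` and its complement in `F`, the second is disjoint
from `G` and disappears. Naturality of the lift rests on this. -/
theorem proj_map {F G E : Ω} (hF : F ≤ E) (hG : G ≤ E) (x : θ.obj F) :
    hθ.proj hG (θ.map hF x) =
      θ.map (inf_le_left : G ⊓ F ≤ G) (hθ.proj (inf_le_right : G ⊓ F ≤ F) x) := by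
  obtain ⟨a, b, rfl⟩ := hθ.exists_eq_map_add_map (inf_le_right : G ⊓ F ≤ F) x
  have hd : Disjoint G (F \ (G ⊓ F)) := by
    rw [sdiff_inf_self_right]
    exact disjoint_sdiff_self_right
  rw [map_add, map_add, map_add, hθ.proj_map_self,
    hθ.proj_map_of_disjoint _ _ disjoint_sdiff_self_right, add_zero, θ.map_map, θ.map_map,
    hθ.proj_map_of_disjoint _ _ hd, add_zero, ← θ.map_map (inf_le_left : G ⊓ F ≤ G) hG,
    hθ.proj_map_self]

end IsCosheaf

/-! ### The lift through evaluation and its uniqueness -/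

variable {𝕜 : Type u} [RCLike 𝕜] {Ω : Type v} [BooleanAlgebra Ω]
  {θ : Precosheaf.{u, v, w'} 𝕜 Ω}
  {B : Type w} [NormedAddCommGroup B] [NormedSpace 𝕜 B] [CompleteSpace B]

theorem Hom.app_map_const (τ : θ.Hom (const 𝕜 Ω B)) {F E : Ω} (h : F ≤ E) (x : θ.obj F) :
    τ.app E (θ.map h x) = τ.app F x :=
  DFunLike.congr_fun (τ.naturality h) x

theorem IsCosheaf.isFinAdditive_app_proj (hθ : θ.IsCosheaf) (τ : θ.Hom (const 𝕜 Ω B)) {E : Ω}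
    (x : θ.obj E) : IsFinAdditive (B := B) fun F : Set.Iic E => τ.app F (hθ.proj F.2 x) := by
  intro F G hd
  have h := hθ.map_proj_add_map_proj (le_sup_left : (F : Ω) ≤ F ⊔ G) le_sup_right
    (Set.Iic.disjoint_coe_iff.2 hd) rfl (hθ.proj (sup_le F.2 G.2) x)
  rw [hθ.proj_proj, hθ.proj_proj] at h
  have h' := congrArg (τ.app ((F : Ω) ⊔ G)) h
  rw [map_add, τ.app_map_const, τ.app_map_const] at h'
  exact h'.symm

theorem IsCosheaf.variation_app_proj_le (hθ : θ.IsCosheaf) (τ : θ.Hom (const 𝕜 Ω B)) {E : Ω}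
    (x : θ.obj E) (H : Set.Iic E) :
    variation (B := B) (fun F : Set.Iic E => τ.app F (hθ.proj F.2 x)) H ≤
      ENNReal.ofReal (‖τ.app E‖ * ‖x‖) := by
  refine (variation_mono (hθ.isFinAdditive_app_proj τ x).map_bot le_top).trans
    (iSup_le fun P => ?_)
  -- Additivity reduces the sum to the value at the unit of the ideal, where the projection is the
  -- identity.
  have hsum : ∑ F ∈ P.parts, ‖hθ.proj F.2 x‖ = ‖x‖ :=
    ((hθ.isFinAdditive_norm_proj x).sum_parts P).trans
      (congrArg norm (hθ.proj_self (le_refl E) x))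
  have hle : ∀ F ∈ P.parts, ‖τ.app F (hθ.proj F.2 x)‖ ≤ ‖τ.app E‖ * ‖hθ.proj F.2 x‖ := by
    intro F _
    -- Replacing `τ_F` by `τ_E ∘ θ_{F,E}` bounds every term by the same constant `‖τ_E‖`, as the
    -- exact norm of the lift requires.
    rw [← τ.app_map_const F.2]
    refine (τ.app E).le_of_opNorm_le_of_le le_rfl ?_
    exact ((θ.map F.2).le_of_opNorm_le (θ.norm_map_le F.2) _).trans_eq (one_mul _)
  rw [← hsum, Finset.mul_sum, ENNReal.ofReal_sum_of_nonneg
    fun _ _ => mul_nonneg (norm_nonneg _) (norm_nonneg _)]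
  refine Finset.sum_le_sum fun F hF => ?_
  exact (_root_.ofReal_norm _).symm.trans_le (ENNReal.ofReal_le_ofReal (hle F hF))

/-- The map into the additive maps of bounded variation on the ideal of `E` that is induced by a
map `τ` to a constant precosheaf and by the spectral measure. -/
def IsCosheaf.liftApp (hθ : θ.IsCosheaf) (τ : θ.Hom (const 𝕜 Ω B)) (E : Ω) :
    θ.obj E →L[𝕜] BVAdditive (Set.Iic E) B 𝕜 :=
  LinearMap.mkContinuous
    { toFun := fun x => BVAdditive.mk (B := B) (fun F : Set.Iic E => τ.app F (hθ.proj F.2 x))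
        (hθ.isFinAdditive_app_proj τ x)
        fun H => (hθ.variation_app_proj_le τ x H).trans_lt ENNReal.ofReal_lt_top
      map_add' := fun x y => BVAdditive.ext fun F =>
        ((τ.app F ∘L hθ.proj F.2).map_add x y :)
      map_smul' := fun c x => BVAdditive.ext fun F =>
        ((τ.app F ∘L hθ.proj F.2).map_smul c x :) } ‖τ.app E‖ fun x =>
    ENNReal.toReal_le_of_le_ofReal (mul_nonneg (norm_nonneg _) (norm_nonneg _))
      (hθ.variation_app_proj_le τ x ⊤)

theorem IsCosheaf.norm_liftApp_le (hθ : θ.IsCosheaf) (τ : θ.Hom (const 𝕜 Ω B)) (E : Ω) :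
    ‖hθ.liftApp τ E‖ ≤ ‖τ.app E‖ :=
  LinearMap.mkContinuous_norm_le _ (norm_nonneg _) _

/-- The map of precosheaves to the additive maps of bounded variation that is induced by a map
`τ` to a constant precosheaf. -/
def IsCosheaf.lift (hθ : θ.IsCosheaf) (τ : θ.Hom (const 𝕜 Ω B)) :
    θ.Hom (bvAdditive 𝕜 Ω B) where
  app E := hθ.liftApp τ E
  naturality {F E} h := ContinuousLinearMap.ext fun x => BVAdditive.ext fun G => by
    change τ.app G (hθ.proj G.2 (θ.map h x)) =
      τ.app ((G : Ω) ⊓ F) (hθ.proj inf_le_right x)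
    exact (congrArg (τ.app G) (hθ.proj_map h G.2 x)).trans (τ.app_map_const _ _)
  bounded := by
    obtain ⟨C, hC⟩ := τ.bounded
    exact ⟨C, fun E => (hθ.norm_liftApp_le τ E).trans (hC E)⟩

theorem norm_bvEval_app_le (E : Ω) : ‖(bvEval 𝕜 Ω B).app E‖ ≤ 1 :=
  ContinuousLinearMap.opNorm_le_bound _ zero_le_one fun ν =>
    (norm_apply_le (show BVAdditive (Set.Iic E) B 𝕜 from ν) ⊤).trans_eq (one_mul _).symm

theorem IsCosheaf.bvEval_comp_lift (hθ : θ.IsCosheaf) (τ : θ.Hom (const 𝕜 Ω B)) :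
    (bvEval 𝕜 Ω B).comp (hθ.lift τ) = τ :=
  Hom.ext (funext fun E => ContinuousLinearMap.ext fun x =>
    congrArg (τ.app E) (hθ.proj_self (le_refl E) x))

/-- Uniqueness of the lift. By naturality, the piece of `x` over `F` gives a measure extended from
`F`, whose value at `F` is its evaluation; the piece over `E \ F` gives one evaluated at `F ⊓ (E \
F) = ⊥`. -/
theorem IsCosheaf.bvApply_eq_of_bvEval_comp_eq (hθ : θ.IsCosheaf) {τ : θ.Hom (const 𝕜 Ω B)}
    {T : θ.Hom (bvAdditive 𝕜 Ω B)} (hT : (bvEval 𝕜 Ω B).comp T = τ) {F E : Ω} (hF : F ≤ E)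
    (x : θ.obj E) : bvApply (T.app E x) ⟨F, hF⟩ = τ.app F (hθ.proj hF x) := by
  obtain ⟨a, b, rfl⟩ := hθ.exists_eq_map_add_map hF x
  have hnat : ∀ {G : Ω} (h : G ≤ E) (y : θ.obj G),
      T.app E (θ.map h y) = bvMap 𝕜 B h (T.app G y) :=
    fun h y => DFunLike.congr_fun (T.naturality h) y
  have ha : bvApply (T.app E (θ.map hF a)) ⟨F, hF⟩ = τ.app F a := by
    subst hT
    rw [hnat]
    exact congrArg (bvApply (T.app F a)) (Subtype.ext (inf_idem F))
  have hb : bvApply (T.app E (θ.map (sdiff_le : E \ F ≤ E) b)) ⟨F, hF⟩ = 0 := by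
    rw [hnat]
    refine (congrArg (bvApply (T.app (E \ F) b)) (Subtype.ext ?_)).trans
      (BVAdditive.isFinAdditive (T.app (E \ F) b)).map_bot
    exact disjoint_iff.1 disjoint_sdiff_self_right
  rw [map_add, map_add, hθ.proj_map_self, hθ.proj_map_of_disjoint _ _ disjoint_sdiff_self_right,
    add_zero, ← ha]
  refine Eq.trans ?_ (add_zero _)
  rw [← hb]
  rfl

/-- One inequality is the variation estimate; the other holds because `τ_E` is the lift followed by
a contraction. -/
theorem IsCosheaf.norm_lift_app (hθ : θ.IsCosheaf) (τ : θ.Hom (const 𝕜 Ω B)) (E : Ω) :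
    ‖(hθ.lift τ).app E‖ = ‖τ.app E‖ := by
  refine le_antisymm (hθ.norm_liftApp_le τ E) ?_
  conv_lhs => rw [← hθ.bvEval_comp_lift τ]
  refine (ContinuousLinearMap.opNorm_comp_le _ _).trans ?_
  exact mul_le_of_le_one_left (norm_nonneg _) (norm_bvEval_app_le E)

end Precosheaf

end

theorem mainTheorem5 {𝕜 : Type u} [RCLike 𝕜] {Ω : Type v} [BooleanAlgebra Ω]
    {B : Type w} [NormedAddCommGroup B] [NormedSpace 𝕜 B] [CompleteSpace B] :
    (Precosheaf.bvAdditive 𝕜 Ω B).IsCosheaf ∧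
    (∀ E : Ω, ‖(Precosheaf.bvEval 𝕜 Ω B).app E‖ ≤ 1) ∧
    ∀ (θ : Precosheaf.{u, v, w'} 𝕜 Ω) (hθ : θ.IsCosheaf)
      (τ : θ.Hom (Precosheaf.const 𝕜 Ω B)),
      ∃ T : θ.Hom (Precosheaf.bvAdditive 𝕜 Ω B),
        (Precosheaf.bvEval 𝕜 Ω B).comp T = τ ∧
        (∀ T' : θ.Hom (Precosheaf.bvAdditive 𝕜 Ω B),
          (Precosheaf.bvEval 𝕜 Ω B).comp T' = τ → T' = T) ∧
        (∀ E : Ω, ‖T.app E‖ = ‖τ.app E‖) ∧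
        ∀ (E : Ω) (x : θ.obj E) (F : Set.Iic E),
          Precosheaf.bvApply (T.app E x) F = τ.app F (hθ.proj F.2 x) ∧
          Precosheaf.bvApply (T.app E x) F = τ.app E (hθ.spectralMeasure E F x) := by
  refine ⟨Precosheaf.isCosheaf_bvAdditive, Precosheaf.norm_bvEval_app_le, fun θ hθ τ =>
    ⟨hθ.lift τ, hθ.bvEval_comp_lift τ, fun T hT => ?_, hθ.norm_lift_app τ, fun E x F =>
      -- The first formula is the definition of the lift; the second uses `τ_F = τ_E ∘ θ_{F,E}`.
      ⟨rfl, (τ.app_map_const F.2 _).symm⟩⟩⟩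
  exact Precosheaf.Hom.ext (funext fun E => ContinuousLinearMap.ext fun x =>
    BVAdditive.ext fun F => hθ.bvApply_eq_of_bvEval_comp_eq hT F.2 x)
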